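/- Let $\mathbb H^3$ be hyperbolic three-space (curvature $-1$) with conformal boundary two-sphere $S^2_\infty$, and let $(A,\Phi)$ be a smooth $SU(2)$ hyperbolic monopole of mass $m>0$ on the trivial rank two Hermitian bundle $E$ over $\mathbb H^3$: $d_A\Phi=*F_A$, $F_A\in L^2$, and $\|\Phi\|\to m$ at infinity, where $\|\Phi\|$ is the operator norm (so $\|\Phi\|=\mu$ if $\Phi$ has eigenvalues $\pm i\mu$, $\mu\ge 0$). Assume that the monopole is nontrivial, i.e. that $F_A$ is not identically zero. For $a\ne b$ in $S^2_\infty$ let $t\mapsto\gamma_{ab}(t)$ be the geodesic, parametrised by arc length, that runs from $a$ to $b$. Let $s_{ab}$, $r_{ab}$ be solutions along $\gamma_{ab}$ of $$(\partial_t^A-i\Phi)s=0,\qquad(\partial_t^A+i\Phi)r=0,\qquad \lim_{t\to\infty}e^{mt}\|s_{ab}(t)\|=1,\qquad \lim_{t\to-\infty}e^{-mt}\|r_{ab}(t)\|=1 .$$ The inner product $(r_{ab},s_{ab})=(r_{ab}(t),s_{ab}(t))$ does not depend on $t$. For $z_1,\dots,z_n\in S^2_\infty$ with $z_i\neq z_{i+1}$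 for $1\le i<n$ and $z_n\ne z_1$ (so $n\ge 2$), with indices taken cyclically, the $n$-point function is $$\langle P_{z_1}\cdots P_{z_n}\rangle=\prod_{i=1}^n (r_{z_iz_{i+1}},s_{z_iz_{i+1}}),$$ where the phases are aligned so that, for each $i$, $\lim_{t\to\infty}e^{mt}s_{z_{i-1}z_i}(t)=\lim_{t\to-\infty}e^{-mt}r_{z_iz_{i+1}}(t)$ in the fibre of $E$ over the boundary point $z_i$. (Fibres over points of the two geodesics near $z_i$ are compared by parallel transport along the short segments, straight in the ball model, that join them.) It is extended to all nonempty tuples by cyclic invariance, $\langle P_z\rangle=1$ and $\langle P_zP_zP_{z_3}\cdots P_{z_n}\rangle=\langle P_zP_{z_3}\cdots P_{z_n}\rangle$ for $n\ge 2$ (so that $\langle P_zP_z\rangle=1$). Then: 1. Whenever $z_i\ne z_{i+1}$ for $1\le i<n$ and $z_n\neq z_1$, one has $|\langle P_{z_1}\cdots P_{z_n}\rangle|<1$, that is, every value given by a choice of solutions as above has modulus less than $1$. 2. Let $\mathcal A$ be an involutive algebra over $\mathbb C$ with elements $P_z=P_z^*$ $(z\in S^2_\infty)$ and a linear functional $\langle\cdot\rangle:\mathcal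 A\to\mathbb C$ with $\langle a^*\rangle=\overline{\langle a\rangle}$ whose value on each product $P_{z_1}\cdots P_{z_n}$, $n\ge1$, is the value of the $n$-point function of $(A,\Phi)$; the boundary algebra of $(A,\Phi)$, which carries derivations and satisfies further relations, is such an algebra. Then $P_{z_1}\neq P_{z_2}$ in $\mathcal A$ whenever $z_1\ne z_2$. -/

import Mathlib

open Filter Topology Set MeasureTheory

noncomputable section

/-- Euclidean three-space; hyperbolic three-space is its open unit ball with the metric
`4 |dx|² / (1 - |x|²)²` of constant curvature `-1`. -/
abbrev E3 : Type := EuclideanSpace ℝ (Fin 3)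

/-- The fibre of the trivial rank two Hermitian bundle. -/
abbrev Fibre : Type := EuclideanSpace ℂ (Fin 2)

/-- Endomorphisms of the fibre, with the operator norm. For an element of `su(2)` with eigenvalues
`± i μ` this norm is `|μ|`. -/
abbrev EndF : Type := Fibre →L[ℂ] Fibre

/-- The Lie algebra `su(2)`: skew-adjoint endomorphisms of trace zero. -/
def su2 : Set EndF :=
  {X | star X = -X ∧ LinearMap.trace ℂ Fibre (X : Fibre →ₗ[ℂ] Fibre) = 0}

/-- Hyperbolic three-space in the ball model. -/
def hyperbolicBall : Set E3 := Metric.ball 0 1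

/-- The conformal boundary two-sphere. -/
abbrev Boundary : Type := Metric.sphere (0 : E3) 1

/-- The standard orthonormal basis vectors of Euclidean space. -/
def stdVec (i : Fin 3) : E3 := EuclideanSpace.single i (1 : ℝ)

/-- `λ⁻¹ = (1 - |x|²) / 2`, where the hyperbolic metric is `λ²` times the Euclidean one. -/
def invConformalFactor (x : E3) : ℝ := (1 - ‖x‖ ^ 2) / 2

/-- Curvature `F_A(u, v) = dA(u, v) + [A(u), A(v)]` of the connection `d + A`. -/
def curvature (A : E3 → E3 →L[ℝ] EndF) (x u v : E3) : EndF :=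
  fderiv ℝ A x u v - fderiv ℝ A x v u + (A x u * A x v - A x v * A x u)

/-- Covariant derivative `d_A Φ (u) = dΦ(u) + [A(u), Φ]`. -/
def covDeriv (A : E3 → E3 →L[ℝ] EndF) (Φ : E3 → EndF) (x u : E3) : EndF :=
  fderiv ℝ Φ x u + (A x u * Φ x - Φ x * A x u)

/-- An `SU(2)` monopole on hyperbolic three-space, of positive mass. The connection and the Higgs
field are smooth on the ball; their values outside the ball play no role. -/
structure HyperbolicMonopole where
  /-- the mass -/
  mass : ℝ
  mass_pos : 0 < mass
  /-- the connection form -/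
  A : E3 → E3 →L[ℝ] EndF
  /-- the Higgs field -/
  Φ : E3 → EndF
  smooth_A : ContDiffOn ℝ (⊤ : ℕ∞) A hyperbolicBall
  smooth_Φ : ContDiffOn ℝ (⊤ : ℕ∞) Φ hyperbolicBall
  A_mem : ∀ x ∈ hyperbolicBall, ∀ u, A x u ∈ su2
  Φ_mem : ∀ x ∈ hyperbolicBall, Φ x ∈ su2
  /-- `d_A Φ = * F_A`. On two-forms in dimension three the Hodge star of `λ² |dx|²` is `λ⁻¹` times
  the Euclidean one; `i, i + 1, i + 2` is a cyclic permutation of the three coordinates. -/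
  bogomolny : ∀ x ∈ hyperbolicBall, ∀ i : Fin 3,
    covDeriv A Φ x (stdVec i) =
      invConformalFactor x • curvature A x (stdVec (i + 1)) (stdVec (i + 2))
  /-- `F_A` is square integrable: `|F|² dvol = λ⁻⁴ |F|²_eucl λ³ dx = λ⁻¹ |F|²_eucl dx`. -/
  curvature_L2 : IntegrableOn
    (fun x => invConformalFactor x *
      ∑ i : Fin 3, ‖curvature A x (stdVec (i + 1)) (stdVec (i + 2))‖ ^ 2) hyperbolicBall volume
  /-- `|Φ| → mass` at infinity, that is, as `|x| ↑ 1`. -/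
  tendsto_norm_Φ : Tendsto (fun x => ‖Φ x‖) (comap (fun x : E3 => ‖x‖) (𝓝[<] 1)) (𝓝 mass)

/-- The hyperbolic geodesic from the boundary point `a` to the boundary point `b ≠ a`, with unit
hyperbolic speed: it tends to `b` as `t → ∞` and to `a` as `t → -∞`. -/
def geodesic (a b : Boundary) (t : ℝ) : E3 :=
  (Real.exp t + Real.exp (-t) + ‖(b : E3) - a‖)⁻¹ •
    (Real.exp t • (b : E3) + Real.exp (-t) • (a : E3))

namespace HyperbolicMonopole

variable (M : HyperbolicMonopole)

/-- The curvature is not identically zero, i.e. the monopole is not the trivial one. -/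
def Nontrivial : Prop :=
  ∃ x ∈ hyperbolicBall, ∃ u v : E3, curvature M.A x u v ≠ 0

/-- `s` solves `(∂_t^A - i Φ) s = 0` along the geodesic from `a` to `b`. -/
def SolvesMinus (a b : Boundary) (s : ℝ → Fibre) : Prop :=
  ∀ t, HasDerivAt s (-(M.A (geodesic a b t) (deriv (geodesic a b) t) (s t))
    + Complex.I • M.Φ (geodesic a b t) (s t)) t

/-- `r` solves `(∂_t^A + i Φ) r = 0` along the geodesic from `a` to `b`. -/
def SolvesPlus (a b : Boundary) (r : ℝ → Fibre) : Prop :=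
  ∀ t, HasDerivAt r (-(M.A (geodesic a b t) (deriv (geodesic a b) t) (r t))
    - Complex.I • M.Φ (geodesic a b t) (r t)) t

/-- `s` is a decaying solution `s₊` with `e^{mt} ‖s‖ → 1` as `t → ∞`. -/
def IsDecayingS (a b : Boundary) (s : ℝ → Fibre) : Prop :=
  M.SolvesMinus a b s ∧ Tendsto (fun t => Real.exp (M.mass * t) * ‖s t‖) atTop (𝓝 1)

/-- `r` is a decaying solution `r₊` with `e^{-mt} ‖r‖ → 1` as `t → -∞`. -/
def IsDecayingR (a b : Boundary) (r : ℝ → Fibre) : Prop :=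
  M.SolvesPlus a b r ∧ Tendsto (fun t => Real.exp (-(M.mass * t)) * ‖r t‖) atBot (𝓝 1)

/-- `w` is the parallel transport of `v` along the straight segment from `x` to `y`. -/
def IsTransport (x y : E3) (v w : Fibre) : Prop :=
  ∃ f : ℝ → Fibre, f 0 = v ∧ f 1 = w ∧ ∀ u ∈ Icc (0 : ℝ) 1,
    HasDerivWithinAt f (-(M.A (x + u • (y - x)) (y - x) (f u))) (Icc 0 1) u

/-- The solutions `s` along the geodesic from `a` to `b` and `r` along the geodesic from `b` to `c`
have the same limit `lim_{t → ∞} e^{mt} s(t) = lim_{t' → -∞} e^{-mt'} r(t')` in the fibre over the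
boundary point `b`. Both geodesics tend to `b`, and the fibres over their points are compared by
parallel transport along the segments, of vanishing length, that join them. This makes the
condition gauge invariant; in a gauge that extends continuously to the boundary it is the equality
of the two limits. -/
def Aligned (a b c : Boundary) (s r : ℝ → Fibre) : Prop :=
  ∃ w : ℝ → Fibre,
    (∀ t, M.IsTransport (geodesic a b t) (geodesic b c (-t))
      ((Real.exp (M.mass * t) : ℂ) • s t) (w t)) ∧
    Tendsto (fun t => w t - (Real.exp (M.mass * t) : ℂ) • r (-t)) atTop (𝓝 0)

/-- The inner product `(r(t), s(t))` of solutions of the two scattering equations, conjugate linear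
in `r`. It does not depend on `t` (`inner_eq_pairing`). -/
def pairing (r s : ℝ → Fibre) : ℂ := inner ℂ (r 0) (s 0)

/-- `c` is the value of the `n`-point function `⟨P_{z_1} ⋯ P_{z_n}⟩` at points with
`z_i ≠ z_{i+1}` and `z_n ≠ z_1`. Indices are cyclic: `i + 1` is computed in `Fin n`. For each `i`,
`r i` and `s i` are the decaying solutions along the geodesic from `z i` to `z (i + 1)`. -/
def IsNPointValue {n : ℕ} [NeZero n] (z : Fin n → Boundary) (c : ℂ) : Prop :=
  (∀ i, z i ≠ z (i + 1)) ∧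
  ∃ r s : Fin n → ℝ → Fibre,
    (∀ i, M.IsDecayingR (z i) (z (i + 1)) (r i)) ∧
    (∀ i, M.IsDecayingS (z i) (z (i + 1)) (s i)) ∧
    (∀ i, M.Aligned (z i) (z (i + 1)) (z (i + 1 + 1)) (s i) (r (i + 1))) ∧
    c = ∏ i, pairing (r i) (s i)

/-- The extension of the `n`-point function to all nonempty tuples: it is cyclically invariant,
`⟨P_z⟩ = 1`, and `⟨P_z P_z P_{z_3} ⋯ P_{z_n}⟩ = ⟨P_z P_{z_3} ⋯ P_{z_n}⟩`. -/
inductive Expectation : List Boundary → ℂ → Prop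
  | generic {n : ℕ} [NeZero n] (z : Fin n → Boundary) (c : ℂ) (h : M.IsNPointValue z c) :
      Expectation (List.ofFn z) c
  | one (z : Boundary) : Expectation [z] 1
  | square (z : Boundary) (l : List Boundary) (c : ℂ) (h : Expectation (z :: l) c) :
      Expectation (z :: z :: l) c
  | rotate (z : Boundary) (l : List Boundary) (c : ℂ) (h : Expectation (l ++ [z]) c) :
      Expectation (z :: l) c

end HyperbolicMonopole

/-- An involutive complex algebra `𝒜` (unital or not) with self-adjoint elements `P_z` and a linear
functional `⟨·⟩` that satisfies `⟨a*⟩ = conj ⟨a⟩` and restricts to the `n`-point function of the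
monopole on the products `P_{z_1} P_{z_2} ⋯ P_{z_n}`, `n ≥ 1`. The boundary algebra of the monopole
is such an algebra, with derivations and further relations; no use is made of these here, so that
whatever holds for all algebras of this kind holds for the boundary algebra. -/
structure ExpectationAlgebra (M : HyperbolicMonopole) (𝒜 : Type*) [NonUnitalRing 𝒜] [StarRing 𝒜]
    [Module ℂ 𝒜] [IsScalarTower ℂ 𝒜 𝒜] [SMulCommClass ℂ 𝒜 𝒜] [StarModule ℂ 𝒜] where
  /-- the generators -/
  P : Boundary → 𝒜
  star_P : ∀ z, star (P z) = P z
  /-- the expectation value -/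
  expect : 𝒜 →ₗ[ℂ] ℂ
  expect_star : ∀ a, expect (star a) = star (expect a)
  expect_word : ∀ (z : Boundary) (l : List Boundary),
    M.Expectation (z :: l) (expect (l.foldl (fun a w => a * P w) (P z)))

/-- The geodesic between distinct boundary points stays in the ball. -/
theorem geodesic_mem {a b : Boundary} (hab : a ≠ b) (t : ℝ) :
    geodesic a b t ∈ hyperbolicBall := by
  have ha : ‖(a : E3)‖ = 1 := by simp
  have hb : ‖(b : E3)‖ = 1 := by simp
  have hd : 0 < ‖(b : E3) - a‖ :=
    norm_pos_iff.2 (sub_ne_zero.2 fun h => hab (Subtype.ext h.symm))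
  have h1 := Real.exp_pos t
  have h2 := Real.exp_pos (-t)
  have hD : 0 < Real.exp t + Real.exp (-t) + ‖(b : E3) - a‖ := by positivity
  have hn : ‖Real.exp t • (b : E3) + Real.exp (-t) • (a : E3)‖ ≤ Real.exp t + Real.exp (-t) := by
    refine (norm_add_le _ _).trans (le_of_eq ?_)
    rw [norm_smul, norm_smul, ha, hb, Real.norm_of_nonneg h1.le, Real.norm_of_nonneg h2.le,
      mul_one, mul_one]
  rw [hyperbolicBall, mem_ball_zero_iff, geodesic, norm_smul, Real.norm_of_nonneg (by positivity),
    inv_mul_lt_iff₀ hD]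
  linarith

/-- The inner product of solutions of the two scattering equations is constant in `t`. -/
theorem HyperbolicMonopole.inner_eq_pairing (M : HyperbolicMonopole) {a b : Boundary} (hab : a ≠ b)
    {r s : ℝ → Fibre} (hr : M.SolvesPlus a b r) (hs : M.SolvesMinus a b s) (t : ℝ) :
    inner ℂ (r t) (s t) = HyperbolicMonopole.pairing r s := by
  have skew : ∀ X ∈ su2, ∀ v w : Fibre, inner ℂ (X v) w = -inner ℂ v (X w) := by
    intro X hX v w
    have h : ContinuousLinearMap.adjoint X = -X := hX.1
    rw [← ContinuousLinearMap.adjoint_inner_right, h]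
    simp
  have hd : ∀ u, HasDerivAt (fun t => inner ℂ (r t) (s t)) 0 u := by
    intro u
    have hx := geodesic_mem hab u
    have h := (hr u).inner ℂ (hs u)
    have e : inner ℂ (r u) (-(M.A (geodesic a b u) (deriv (geodesic a b) u) (s u))
        + Complex.I • M.Φ (geodesic a b u) (s u)) +
        inner ℂ (-(M.A (geodesic a b u) (deriv (geodesic a b) u) (r u))
        - Complex.I • M.Φ (geodesic a b u) (r u)) (s u) = 0 := by
      rw [inner_add_right, inner_sub_left, inner_neg_left, inner_neg_right, inner_smul_left,
        inner_smul_right, skew _ (M.A_mem _ hx _), skew _ (M.Φ_mem _ hx), Complex.conj_I]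
      ring
    rwa [e] at h
  exact is_const_of_deriv_eq_zero (fun u => (hd u).differentiableAt) (fun u => (hd u).deriv) t 0

end

/-! Everything rests on the strict bound `‖Φ‖ < m` on the whole ball (`norm_Φ_lt_mass`).

Given the bound, `(e^{mt}‖s‖)²` has derivative at least `2(m - ‖Φ‖)` times itself: the connection is
skew and drops out, while `iΦ` shrinks `s` at rate at most `‖Φ‖`. Thus it increases strictly to its
limit 1, and `‖s(0)‖ < 1`. Reversing time gives `‖r(0)‖ < 1`, so by Cauchy-Schwarz every factor of
an n-point value has modulus below 1. The algebra statement follows because `⟨P_z P_z⟩ = 1` while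
`|⟨P_z P_w⟩| < 1` for `z ≠ w`.

The bound comes from the maximum principle. The Bogomolny equation and the Bianchi identity give
`Δ|Φ|² = 2|d_A Φ|² ≥ 0` (`laplacian_energy`), so `|Φ|² ≤ m²` (`energy_le`). If equality held
everywhere, `d_A Φ` and hence the curvature would vanish; a nontrivial monopole therefore has a
point `y` with `|Φ(y)| < m`. Strictness spreads from `y` to the whole ball at once: `exp(-β(cosh
d(y,·) - 1))` is strictly subharmonic off a small ball about `y` and tends to 0 at infinity, so a
small multiple of it can be added to `|Φ|²` without exceeding `m²` (`energy_lt_of_exists`). -/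

theorem HasDerivAt.of_eq {V : Type*} [NormedAddCommGroup V] [NormedSpace ℝ V] {f g : ℝ → V}
    {a b : V} {t : ℝ} (h : HasDerivAt f a t) (e : ∀ u, f u = g u) (ea : a = b) :
    HasDerivAt g b t := by
  obtain rfl := funext e
  exact ea ▸ h

/-! ### Linear algebra of su(2) -/

theorem inner_apply_left_of_mem_su2 {X : EndF} (hX : X ∈ su2) (v w : Fibre) :
    inner ℂ (X v) w = -inner ℂ v (X w) := by
  have h : ContinuousLinearMap.adjoint X = -X := hX.1
  rw [← ContinuousLinearMap.adjoint_inner_right, h]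
  simp

theorem re_inner_apply_self_of_mem_su2 {X : EndF} (hX : X ∈ su2) (v : Fibre) :
    (inner ℂ v (X v)).re = 0 := by
  have h := congrArg Complex.re (inner_apply_left_of_mem_su2 hX v v)
  rw [← inner_conj_symm] at h
  simp only [Complex.conj_re, Complex.neg_re] at h
  linarith

/-- The real part of the trace. -/
noncomputable def reTrace : EndF →L[ℝ] ℝ :=
  LinearMap.toContinuousLinearMap
    (Complex.reLm ∘ₗ ((LinearMap.trace ℂ Fibre) ∘ₗ
      (ContinuousLinearMap.coeLM ℂ : EndF →ₗ[ℂ] (Fibre →ₗ[ℂ] Fibre))).restrictScalars ℝ)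

theorem reTrace_apply (X : EndF) :
    reTrace X = (LinearMap.trace ℂ Fibre (X : Fibre →ₗ[ℂ] Fibre)).re := rfl

theorem reTrace_mul_comm (X Y : EndF) : reTrace (X * Y) = reTrace (Y * X) := by
  rw [reTrace_apply, reTrace_apply]
  exact congrArg Complex.re (LinearMap.trace_mul_comm ℂ (X : Fibre →ₗ[ℂ] Fibre) Y)

/-- The invariant form `-tr(XY)/2`, whose quadratic form on `su(2)` is the squared operator norm. -/
noncomputable def trForm (X Y : EndF) : ℝ := -(1 / 2) * reTrace (X * Y)

theorem trForm_comm (X Y : EndF) : trForm X Y = trForm Y X := by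
  rw [trForm, reTrace_mul_comm, trForm]

theorem trForm_add_left (X Y Z : EndF) : trForm (X + Y) Z = trForm X Z + trForm Y Z := by
  simp only [trForm, add_mul, map_add, mul_add]

theorem trForm_smul_left (c : ℝ) (X Y : EndF) : trForm (c • X) Y = c * trForm X Y := by
  have e : (c • X) * Y = c • (X * Y) := rfl
  rw [trForm, e, map_smul, smul_eq_mul, trForm]; ring

/-- Invariance of the form under the adjoint action; it lets covariant derivatives replace partial
ones in the product rule. -/
theorem trForm_commutator_add (T X Y : EndF) :
    trForm (T * X - X * T) Y + trForm X (T * Y - Y * T) = 0 := by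
  have h := reTrace_mul_comm T (X * Y)
  simp only [trForm, sub_mul, mul_sub, map_sub, ← mul_assoc] at h ⊢
  rw [h]; ring

/-- Cayley-Hamilton for a traceless 2 × 2 matrix: the square is minus the determinant. -/
theorem exists_mul_self_eq_smul_one {X : EndF}
    (hX : LinearMap.trace ℂ Fibre (X : Fibre →ₗ[ℂ] Fibre) = 0) : ∃ c : ℂ, X * X = c • 1 := by
  let b := (EuclideanSpace.basisFun (Fin 2) ℂ).toBasis
  let N := LinearMap.toMatrix b b (X : Fibre →ₗ[ℂ] Fibre)
  have hN : N 1 1 = -N 0 0 := by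
    rw [LinearMap.trace_eq_matrix_trace ℂ b, Matrix.trace_fin_two] at hX
    exact eq_neg_of_add_eq_zero_right hX
  refine ⟨N 0 0 ^ 2 + N 0 1 * N 1 0, ?_⟩
  have h : N * N = (N 0 0 ^ 2 + N 0 1 * N 1 0) • (1 : Matrix (Fin 2) (Fin 2) ℂ) := by
    ext i j
    fin_cases i <;> fin_cases j <;>
      simp [Matrix.mul_apply, Fin.sum_univ_two, hN] <;> ring
  apply ContinuousLinearMap.coe_injective
  apply (LinearMap.toMatrix b b).injective
  have e : LinearMap.toMatrix b b ((X * X : EndF) : Fibre →ₗ[ℂ] Fibre) = N * N :=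
    LinearMap.toMatrix_mul b (X : Fibre →ₗ[ℂ] Fibre) X
  rw [e, h]
  have e1 : (((N 0 0 ^ 2 + N 0 1 * N 1 0) • (1 : EndF) : EndF) : Fibre →ₗ[ℂ] Fibre) =
    (N 0 0 ^ 2 + N 0 1 * N 1 0) • (1 : Fibre →ₗ[ℂ] Fibre) := rfl
  rw [e1, map_smul, LinearMap.toMatrix_one]

/-- With `X² = c`, the C*-identity gives `‖X‖² = |c|`, and the form equals `-Re c`. Skewness gives
`‖Xv‖² = -c‖v‖²`, so `c` is real and nonpositive and the two agree. -/
theorem trForm_self {X : EndF} (hX : X ∈ su2) : trForm X X = ‖X‖ ^ 2 := by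
  obtain ⟨c, hc⟩ := exists_mul_self_eq_smul_one hX.2
  have hB : trForm X X = -c.re := by
    rw [trForm, hc, reTrace_apply]
    have e1 : ((c • (1 : EndF) : EndF) : Fibre →ₗ[ℂ] Fibre) = c • (1 : Fibre →ₗ[ℂ] Fibre) := rfl
    rw [e1, map_smul, LinearMap.trace_one]
    simp
    ring
  have hn : ‖X‖ ^ 2 = ‖c‖ := by
    have e : -X * X = -(X * X) := neg_mul X X
    rw [sq, ← CStarRing.norm_star_mul_self, hX.1, e, norm_neg, hc, norm_smul, norm_one,
      mul_one]
  have hv : ∀ v : Fibre, ((‖X v‖ ^ 2 : ℝ) : ℂ) = -c * ((‖v‖ ^ 2 : ℝ) : ℂ) := by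
    intro v
    have h1 : inner ℂ (X v) (X v) = -inner ℂ v ((X * X) v) :=
      inner_apply_left_of_mem_su2 hX v (X v)
    rw [hc] at h1
    simp only [smul_apply, one_apply_eq_self, inner_smul_right,
      inner_self_eq_norm_sq_to_K] at h1
    push_cast
    rw [neg_mul]
    exact h1
  have h1 := hv (EuclideanSpace.single 0 1)
  simp only [PiLp.norm_single, norm_one, one_pow, Complex.ofReal_one, mul_one] at h1
  have hc' : c = ((-‖X (EuclideanSpace.single 0 1)‖ ^ 2 : ℝ) : ℂ) := by
    push_cast at h1 ⊢
    rw [h1, neg_neg]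
  rw [hB, hn, hc', Complex.ofReal_re, Complex.norm_real, norm_neg, Real.norm_of_nonneg
    (by positivity)]
  ring

/-! ### Growth along geodesics, and both conclusions from the strict bound -/

namespace HyperbolicMonopole

variable (M : HyperbolicMonopole)

theorem SolvesMinus.hasDerivAt_norm_sq {M : HyperbolicMonopole} {a b : Boundary} (hab : a ≠ b)
    {s : ℝ → Fibre} (hs : M.SolvesMinus a b s) (t : ℝ) :
    ∃ d, HasDerivAt (fun t => (Real.exp (M.mass * t) * ‖s t‖) ^ 2) d t ∧
      2 * (M.mass - ‖M.Φ (geodesic a b t)‖) * (Real.exp (M.mass * t) * ‖s t‖) ^ 2 ≤ d := by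
  have hx := geodesic_mem hab t
  have hA := re_inner_apply_self_of_mem_su2 (M.A_mem _ hx (deriv (geodesic a b) t)) (s t)
  set A' := M.A (geodesic a b t) (deriv (geodesic a b) t)
  set Φ' := M.Φ (geodesic a b t)
  have h1 := ((hs t).inner ℂ (hs t))
  have h2 : HasDerivAt (fun t => ‖s t‖ ^ 2)
      (2 * (inner ℂ (s t) (-(A' (s t)) + Complex.I • Φ' (s t))).re) t := by
    have h3 := Complex.reCLM.hasFDerivAt.comp_hasDerivAt t h1
    refine h3.of_eq (fun u => ?_) ?_
    · simp [inner_self_eq_norm_sq_to_K, ← Complex.ofReal_pow]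
    · change (inner ℂ (s t) (-(A' (s t)) + Complex.I • Φ' (s t)) +
        inner ℂ (-(A' (s t)) + Complex.I • Φ' (s t)) (s t)).re = _
      rw [Complex.add_re]
      rw [← inner_conj_symm (-(A' (s t)) + Complex.I • Φ' (s t)) (s t), Complex.conj_re]
      ring
  have h4 : HasDerivAt (fun t => Real.exp (M.mass * t)) (Real.exp (M.mass * t) * (M.mass * 1)) t :=
    ((hasDerivAt_id t).const_mul M.mass).exp
  have h5 := (h4.pow 2).mul h2
  refine ⟨_, h5.of_eq (fun u => by simp [mul_pow]) rfl, ?_⟩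
  have hb : -(‖Φ'‖ * ‖s t‖ ^ 2) ≤ (inner ℂ (s t) (-(A' (s t)) + Complex.I • Φ' (s t))).re := by
    rw [inner_add_right, inner_neg_right, Complex.add_re, Complex.neg_re, hA, neg_zero, zero_add]
    have : ‖inner ℂ (s t) (Complex.I • Φ' (s t))‖ ≤ ‖Φ'‖ * ‖s t‖ ^ 2 := by
      refine (norm_inner_le_norm _ _).trans ?_
      rw [norm_smul, Complex.norm_I, one_mul]
      nlinarith [Φ'.le_opNorm (s t), norm_nonneg (s t)]
    have h6 := (abs_le.1 ((Complex.abs_re_le_norm _).trans this)).1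
    exact h6
  have hE : 0 < Real.exp (M.mass * t) ^ 2 := by positivity
  have := mul_le_mul_of_nonneg_left hb hE.le
  simp only [mul_pow, Pi.pow_apply, Nat.cast_ofNat, Nat.add_one_sub_one, pow_one, mul_one]
  linear_combination 2 * this

theorem monotone_of_norm_Φ_le (hΦ : ∀ x ∈ hyperbolicBall, ‖M.Φ x‖ ≤ M.mass)
    {a b : Boundary} (hab : a ≠ b) {s : ℝ → Fibre} (hs : M.SolvesMinus a b s) :
    Monotone (fun t => (Real.exp (M.mass * t) * ‖s t‖) ^ 2) := by
  choose d hd hle using hs.hasDerivAt_norm_sq hab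
  refine monotone_of_hasDerivAt_nonneg hd fun t => le_trans ?_ (hle t)
  have := sub_nonneg.2 (hΦ _ (geodesic_mem hab t))
  positivity

/-- A monotone function with limit 1 that already equals 1 at time 0 is constant afterwards, which
contradicts its positive derivative. -/
theorem IsDecayingS.norm_lt_one {M : HyperbolicMonopole}
    (hΦ : ∀ x ∈ hyperbolicBall, ‖M.Φ x‖ < M.mass)
    {a b : Boundary} (hab : a ≠ b) {s : ℝ → Fibre} (hs : M.IsDecayingS a b s) : ‖s 0‖ < 1 := by
  have hmono := M.monotone_of_norm_Φ_le (fun x hx => (hΦ x hx).le) hab hs.1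
  have hlim : Tendsto (fun t => (Real.exp (M.mass * t) * ‖s t‖) ^ 2) atTop (𝓝 1) := by
    simpa using hs.2.pow 2
  have hle := fun t => hmono.ge_of_tendsto hlim t
  have h0 := hle 0
  simp only [mul_zero, Real.exp_zero, one_mul] at h0
  refine lt_of_le_of_ne (by nlinarith [norm_nonneg (s 0)]) fun he => ?_
  have hconst : ∀ t, 0 ≤ t → (Real.exp (M.mass * t) * ‖s t‖) ^ 2 = 1 := by
    intro t ht
    refine le_antisymm (hle t) ?_
    have := hmono ht
    simpa [he] using this
  -- Constancy is known only for `t ≥ 0`, so the derivative is taken at an interior point.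
  obtain ⟨d, hd, hdle⟩ := hs.1.hasDerivAt_norm_sq hab 1
  have hd0 : d = 0 := by
    refine hd.unique ((hasDerivAt_const (1 : ℝ) (1 : ℝ)).congr_of_eventuallyEq ?_)
    filter_upwards [lt_mem_nhds (zero_lt_one' ℝ)] with t ht using hconst t ht.le
  rw [hconst 1 zero_le_one, hd0] at hdle
  linarith [hΦ _ (geodesic_mem hab 1)]

theorem geodesic_neg (a b : Boundary) (t : ℝ) : geodesic a b (-t) = geodesic b a t := by
  simp only [geodesic, neg_neg, norm_sub_rev (b : E3) a]
  congr 1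
  · rw [add_comm (Real.exp (-t))]
  · rw [add_comm]

/-- Time reversal reverses the geodesic and exchanges the two scattering equations, so estimates for
`s` suffice. -/
theorem IsDecayingR.isDecayingS_comp_neg {M : HyperbolicMonopole} {a b : Boundary}
    {r : ℝ → Fibre} (hr : M.IsDecayingR a b r) : M.IsDecayingS b a (fun t => r (-t)) := by
  refine ⟨fun t => ?_, ?_⟩
  · have h := (hr.1 (-t)).scomp t (hasDerivAt_neg t)
    have hg : geodesic b a = fun t => geodesic a b (-t) := by
      funext u; rw [geodesic_neg]
    have hg' : deriv (geodesic b a) t = -deriv (geodesic a b) (-t) := by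
      rw [hg, deriv_comp_neg]
    rw [hg', ← geodesic_neg]
    refine h.of_eq (fun _ => rfl) ?_
    simp only [map_neg, _root_.neg_apply]
    module
  · have h := hr.2.comp tendsto_neg_atTop_atBot
    refine h.congr fun t => ?_
    simp

theorem norm_pairing_lt_one (hΦ : ∀ x ∈ hyperbolicBall, ‖M.Φ x‖ < M.mass)
    {a b : Boundary} (hab : a ≠ b) {r s : ℝ → Fibre} (hr : M.IsDecayingR a b r)
    (hs : M.IsDecayingS a b s) : ‖pairing r s‖ < 1 := by
  have h1 := hs.norm_lt_one hΦ hab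
  have h2 := hr.isDecayingS_comp_neg.norm_lt_one hΦ hab.symm
  rw [neg_zero] at h2
  refine (norm_inner_le_norm _ _).trans_lt ?_
  nlinarith [norm_nonneg (s 0), norm_nonneg (r 0)]

theorem IsNPointValue.norm_lt_one {M : HyperbolicMonopole}
    (hΦ : ∀ x ∈ hyperbolicBall, ‖M.Φ x‖ < M.mass) {n : ℕ} [NeZero n]
    {z : Fin n → Boundary} {c : ℂ} (h : M.IsNPointValue z c) : ‖c‖ < 1 := by
  obtain ⟨hz, r, s, hr, hs, -, rfl⟩ := h
  have hlt : ∀ i, ‖pairing (r i) (s i)‖ < 1 := fun i => M.norm_pairing_lt_one hΦ (hz i) (hr i) (hs i)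
  -- One factor is split off to supply strictness; the others need only be at most 1.
  rw [norm_prod, ← Finset.mul_prod_erase _ _ (Finset.mem_univ 0)]
  refine (mul_le_of_le_one_right (norm_nonneg _) ?_).trans_lt (hlt 0)
  exact Finset.prod_le_one (fun i _ => norm_nonneg _) fun i _ => (hlt i).le

/-- The three claims are proved together because the rules link them: squaring passes from `[z]` to
`[z, z]`, and rotation exchanges the entries of a pair. -/
theorem Expectation.short {M : HyperbolicMonopole}
    (hΦ : ∀ x ∈ hyperbolicBall, ‖M.Φ x‖ < M.mass) {l : List Boundary} {c : ℂ}
    (h : M.Expectation l c) :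
    (∀ z, l = [z] → c = 1) ∧ (∀ z, l = [z, z] → c = 1) ∧
      ∀ z w, z ≠ w → l = [z, w] → ‖c‖ < 1 := by
  induction h with
  | @generic n _ z c h =>
    refine ⟨fun w hw => ?_, fun w hw => ?_, fun _ _ _ _ => h.norm_lt_one hΦ⟩
    -- In `Fin 1` one has `i + 1 = i`, so no generic tuple has length one.
    · obtain rfl : n = 1 := by simpa using congrArg List.length hw
      exact absurd (congrArg z (Subsingleton.elim _ _)) (h.1 0)
    · obtain rfl : n = 2 := by simpa using congrArg List.length hw
      simp [List.ofFn_succ] at hw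
      exact absurd (hw.1.trans hw.2.symm) (h.1 0)
  | one z => exact ⟨fun _ _ => rfl, fun _ _ => rfl, fun _ _ _ h => by simp at h⟩
  | square z l c h ih =>
    refine ⟨fun w hw => by simp at hw, fun w hw => ?_, fun w w' hne hw => ?_⟩
    · simp only [List.cons.injEq] at hw
      exact ih.1 z (by rw [hw.2.2])
    · simp only [List.cons.injEq] at hw
      exact absurd (hw.1.symm.trans hw.2.1) hne
  | rotate z l c h ih =>
    refine ⟨fun w hw => ?_, fun w hw => ?_, fun w w' hne hw => ?_⟩ <;>
      simp only [List.cons.injEq] at hw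
    · exact ih.1 z (by rw [hw.2]; rfl)
    · exact ih.2.1 w (by rw [hw.2, hw.1]; rfl)
    · exact ih.2.2 w' w hne.symm (by rw [hw.2, hw.1]; rfl)

theorem P_ne_of_norm_Φ_lt {M : HyperbolicMonopole}
    (hΦ : ∀ x ∈ hyperbolicBall, ‖M.Φ x‖ < M.mass) {𝒜 : Type*} [NonUnitalRing 𝒜] [StarRing 𝒜]
    [Module ℂ 𝒜] [IsScalarTower ℂ 𝒜 𝒜] [SMulCommClass ℂ 𝒜 𝒜] [StarModule ℂ 𝒜]
    (S : ExpectationAlgebra M 𝒜) {z₁ z₂ : Boundary} (hz : z₁ ≠ z₂) : S.P z₁ ≠ S.P z₂ := by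
  intro he
  have h1 := ((S.expect_word z₁ [z₁]).short hΦ).2.1 z₁ rfl
  have h2 := ((S.expect_word z₁ [z₂]).short hΦ).2.2 z₁ z₂ hz rfl
  simp only [List.foldl] at h1 h2
  rw [← he, h1] at h2
  simp at h2

end HyperbolicMonopole

/-! ### Second-order jets along lines and the maximum principle -/

/-- `a` and `b` are the first and second derivatives at `t = 0` of `t ↦ h (x + t v)`. -/
def HasLineJet (h : E3 → ℝ) (x v : E3) (a b : ℝ) : Prop :=
  ∃ φ : ℝ → ℝ, (∀ᶠ t in 𝓝 (0 : ℝ), HasDerivAt (fun t : ℝ => h (x + t • v)) (φ t) t) ∧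
    φ 0 = a ∧ HasDerivAt φ b 0

theorem HasLineJet.add_const_mul {h k : E3 → ℝ} {x v : E3} {a b a' b' : ℝ}
    (hh : HasLineJet h x v a b) (hk : HasLineJet k x v a' b') (c : ℝ) :
    HasLineJet (fun y => h y + c * k y) x v (a + c * a') (b + c * b') := by
  obtain ⟨φ, h1, rfl, h2⟩ := hh
  obtain ⟨ψ, k1, rfl, k2⟩ := hk
  refine ⟨fun t => φ t + c * ψ t, ?_, rfl, h2.add (k2.const_mul c)⟩
  filter_upwards [h1, k1] with t ht kt using ht.add (kt.const_mul c)

theorem HasLineJet.of_isLocalMax {h : E3 → ℝ} {x v : E3} {a b : ℝ}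
    (hj : HasLineJet h x v a b) (hm : IsLocalMax h x) : a = 0 ∧ b ≤ 0 := by
  obtain ⟨φ, h1, rfl, h2⟩ := hj
  set g : ℝ → ℝ := fun t => h (x + t • v) with hg
  have hgm : IsLocalMax g 0 := by
    have hc : Tendsto (fun t : ℝ => x + t • v) (𝓝 0) (𝓝 x) := by
      have : Continuous (fun t : ℝ => x + t • v) := by fun_prop
      simpa using this.tendsto 0
    have := hc.eventually hm
    filter_upwards [this] with t ht
    simpa [hg] using ht
  have hd : deriv g =ᶠ[𝓝 0] φ := by
    filter_upwards [h1] with t ht using ht.deriv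
  have h0 : φ 0 = 0 := by
    rw [← hd.self_of_nhds]; exact hgm.deriv_eq_zero
  refine ⟨h0, not_lt.1 fun hb => ?_⟩
  have hdd : deriv (deriv g) 0 = b := by rw [hd.deriv_eq, h2.deriv]
  -- A positive second derivative would make the local maximum also a local minimum, hence `g`
  -- locally constant, with second derivative 0.
  have hmin : IsLocalMin g 0 :=
    isLocalMin_of_deriv_deriv_pos (by rw [hdd]; exact hb) (by rw [hd.self_of_nhds, h0])
      h1.self_of_nhds.continuousAt
  have hcst : g =ᶠ[𝓝 0] fun _ => g 0 := by
    filter_upwards [hgm, hmin] with t h1 h2 using le_antisymm h1 h2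
  have : deriv (deriv g) 0 = 0 := by
    have e : deriv g =ᶠ[𝓝 0] fun _ => 0 := by
      have := hcst.deriv
      simpa using this
    rw [e.deriv_eq]; simp
  linarith

theorem exists_lt_forall_of_eventually_comap {p : E3 → Prop}
    (h : ∀ᶠ x in comap (fun x : E3 => ‖x‖) (𝓝[<] 1), p x) :
    ∃ r < 1, ∀ x : E3, r < ‖x‖ → ‖x‖ < 1 → p x := by
  rw [eventually_comap] at h
  obtain ⟨r, hr, hsub⟩ := (mem_nhdsLT_iff_exists_Ioo_subset (a := (1 : ℝ))).1 h
  exact ⟨r, hr, fun x h1 h2 => hsub ⟨h1, h2⟩ x rfl⟩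

/-- Maximum principle for strict subsolutions of the Laplace equation of hyperbolic space. -/
theorem le_of_strict_subsolution {K : ℝ} {h : E3 → ℝ} (hc : ContinuousOn h hyperbolicBall)
    (hlim : ∀ K' > K, ∀ᶠ x in comap (fun x : E3 => ‖x‖) (𝓝[<] 1), h x < K')
    (hL : ∀ x ∈ hyperbolicBall, h x ≤ K ∨ ∃ a b : Fin 3 → ℝ,
      (∀ i, HasLineJet h x (stdVec i) (a i) (b i)) ∧
      0 < invConformalFactor x * ∑ i, b i + ∑ i, x i * a i) :
    ∀ x ∈ hyperbolicBall, h x ≤ K := by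
  intro x₀ hx₀
  by_contra! hK
  -- Outside radius `r` the function stays below `h x₀`, so its maximum over the closed ball of
  -- radius `r` is a maximum over the whole open ball.
  obtain ⟨r, hr1, hr⟩ := exists_lt_forall_of_eventually_comap (hlim _ hK)
  have hx₀' : ‖x₀‖ < 1 := mem_ball_zero_iff.1 hx₀
  have hx₀r : ‖x₀‖ ≤ r := not_lt.1 fun hlt => lt_irrefl _ (hr x₀ hlt hx₀')
  obtain ⟨y, hy, hmax⟩ := (isCompact_closedBall (0 : E3) r).exists_isMaxOn
    ⟨x₀, mem_closedBall_zero_iff.2 hx₀r⟩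
    (hc.mono (Metric.closedBall_subset_ball hr1))
  have hxy : h x₀ ≤ h y := hmax (mem_closedBall_zero_iff.2 hx₀r)
  have hyb : y ∈ hyperbolicBall := Metric.closedBall_subset_ball hr1 hy
  have hloc : IsLocalMax h y := by
    filter_upwards [Metric.isOpen_ball.mem_nhds hyb] with w hw
    by_cases hwr : ‖w‖ ≤ r
    · exact hmax (mem_closedBall_zero_iff.2 hwr)
    · exact (hr w (not_le.1 hwr) (mem_ball_zero_iff.1 hw)).le.trans hxy
  rcases hL y hyb with hle | ⟨a, b, hj, hpos⟩
  · linarith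
  · have ha : ∀ i, a i = 0 := fun i => ((hj i).of_isLocalMax hloc).1
    have hb : ∑ i, b i ≤ 0 := Finset.sum_nonpos fun i _ => ((hj i).of_isLocalMax hloc).2
    have hy1 : ‖y‖ < 1 := mem_ball_zero_iff.1 hyb
    have hp : 0 < invConformalFactor y := by
      rw [invConformalFactor]; nlinarith [norm_nonneg y]
    simp only [ha, mul_zero, Finset.sum_const_zero, add_zero] at hpos
    nlinarith

/-! ### The barrier built from hyperbolic distance -/

theorem norm_sq_add_smul_stdVec (x : E3) (i : Fin 3) (t : ℝ) :
    ‖x + t • stdVec i‖ ^ 2 = ‖x‖ ^ 2 + 2 * x i * t + t ^ 2 := by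
  rw [norm_add_sq_real, inner_smul_right, norm_smul, stdVec, EuclideanSpace.inner_single_right]
  simp
  ring

theorem norm_sq_eq_sum (x : E3) : ‖x‖ ^ 2 = ∑ i, x i ^ 2 := EuclideanSpace.real_norm_sq_eq x

theorem hasLineJet_norm_sq_sub (y x : E3) (i : Fin 3) :
    HasLineJet (fun x => ‖x - y‖ ^ 2) x (stdVec i) (2 * (x i - y i)) 2 := by
  refine ⟨fun t => 2 * (x i - y i) + 2 * t, Eventually.of_forall fun t => ?_, by simp, ?_⟩
  · have e : (fun t : ℝ => ‖x + t • stdVec i - y‖ ^ 2) =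
        fun t => ‖x - y‖ ^ 2 + 2 * (x i - y i) * t + t ^ 2 := by
      funext t
      rw [add_sub_right_comm, norm_sq_add_smul_stdVec]; simp
    rw [e]
    have := (((hasDerivAt_id t).const_mul (2 * (x i - y i))).const_add (‖x - y‖ ^ 2)).add
      ((hasDerivAt_id t).pow 2)
    exact this.of_eq (fun _ => by simp) (by simp)
  · simpa using ((hasDerivAt_id (0 : ℝ)).const_mul 2).const_add (2 * (x i - y i))

/-- `cosh d - 1`, where `d` is the hyperbolic distance to `y`. -/
noncomputable def coshDistSubOne (y x : E3) : ℝ := 2 * ‖x - y‖ ^ 2 / ((1 - ‖x‖ ^ 2) * (1 - ‖y‖ ^ 2))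

theorem HasLineJet.exp {h : E3 → ℝ} {x v : E3} {a b : ℝ}
    (hh : HasLineJet h x v a b) (c : ℝ) :
    HasLineJet (fun y => Real.exp (c * h y)) x v (Real.exp (c * h x) * (c * a))
      (Real.exp (c * h x) * ((c * a) ^ 2 + c * b)) := by
  obtain ⟨φ, h1, rfl, h2⟩ := hh
  refine ⟨fun t => Real.exp (c * h (x + t • v)) * (c * φ t), ?_, by simp, ?_⟩
  · filter_upwards [h1] with t ht using (ht.const_mul c).exp
  · have := (h1.self_of_nhds.const_mul c).exp.mul (h2.const_mul c)
    refine this.of_eq (fun _ => rfl) ?_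
    simp; ring

theorem HasLineJet.div {h k : E3 → ℝ} {x v : E3} {a b a' b' : ℝ}
    (hh : HasLineJet h x v a b) (hk : HasLineJet k x v a' b') (h0 : k x ≠ 0) :
    HasLineJet (fun y => h y / k y) x v ((a * k x - h x * a') / k x ^ 2)
      (((b * k x - h x * b') * k x - 2 * a' * (a * k x - h x * a')) / k x ^ 3) := by
  obtain ⟨φ, h1, rfl, h2⟩ := hh
  obtain ⟨ψ, k1, rfl, k2⟩ := hk
  have h0' : k (x + (0 : ℝ) • v) ≠ 0 := by simpa using h0
  have hne : ∀ᶠ t in 𝓝 (0 : ℝ), k (x + t • v) ≠ 0 :=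
    k1.self_of_nhds.continuousAt.eventually_ne h0'
  refine ⟨fun t => (φ t * k (x + t • v) - h (x + t • v) * ψ t) / k (x + t • v) ^ 2, ?_, by simp, ?_⟩
  · filter_upwards [h1, k1, hne] with t ht kt h0 using ht.div kt h0
  · have := ((h2.mul k1.self_of_nhds).sub (h1.self_of_nhds.mul k2)).div
      (k1.self_of_nhds.pow 2) (pow_ne_zero 2 h0')
    refine this.of_eq (fun _ => rfl) ?_
    simp
    field_simp
    ring

theorem HasLineJet.const (c : ℝ) (x v : E3) : HasLineJet (fun _ => c) x v 0 0 :=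
  ⟨fun _ => 0, Eventually.of_forall fun t => hasDerivAt_const t c, rfl, hasDerivAt_const _ _⟩

theorem HasLineJet.congr {h k : E3 → ℝ} {x v : E3} {a b a' b' : ℝ}
    (hh : HasLineJet h x v a b) (e : h = k) (ea : a = a') (eb : b = b') :
    HasLineJet k x v a' b' := by subst e ea eb; exact hh

theorem hasLineJet_one_sub_norm_sq (x : E3) (i : Fin 3) :
    HasLineJet (fun x => 1 - ‖x‖ ^ 2) x (stdVec i) (-2 * x i) (-2) := by
  refine ((HasLineJet.const 1 x (stdVec i)).add_const_mul
    (hasLineJet_norm_sq_sub 0 x i) (-1)).congr ?_ ?_ ?_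
  · funext y; simp; ring
  · simp
  · norm_num

/-- On the set `u - 1 ≥ δ` the function `exp (-β u)`, `β δ > 3`, is strictly subharmonic. -/
theorem exists_hasLineJet_barrier {y x : E3} (hy : y ∈ hyperbolicBall) (hx : x ∈ hyperbolicBall)
    {δ β : ℝ} (hδ : 0 < δ) (hβ : 3 < β * δ) (hU : δ ≤ coshDistSubOne y x) :
    ∃ a b : Fin 3 → ℝ,
      (∀ i, HasLineJet (fun x => Real.exp (-β * coshDistSubOne y x)) x (stdVec i) (a i) (b i)) ∧
      0 < invConformalFactor x * ∑ i, b i + ∑ i, x i * a i := by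
  have hy1 : ‖y‖ < 1 := mem_ball_zero_iff.1 hy
  have hx1 : ‖x‖ < 1 := mem_ball_zero_iff.1 hx
  have hp : 0 < 1 - ‖x‖ ^ 2 := by nlinarith [norm_nonneg x]
  have hk : 0 < 1 - ‖y‖ ^ 2 := by nlinarith [norm_nonneg y]
  have hq := fun i => ((hasLineJet_norm_sq_sub y x i).div (hasLineJet_one_sub_norm_sq x i) hp.ne')
  have hV := fun i => (((HasLineJet.const 0 x (stdVec i)).add_const_mul (hq i)
    (2 / (1 - ‖y‖ ^ 2))).congr (k := coshDistSubOne y) (by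
      funext w; simp only [coshDistSubOne]; rw [zero_add, div_mul_div_comm, mul_comm (1 - ‖y‖ ^ 2)])
      rfl rfl).exp (-β)
  refine ⟨_, _, hV, ?_⟩
  have hU2 : coshDistSubOne y x = 2 * ‖x - y‖ ^ 2 / ((1 - ‖x‖ ^ 2) * (1 - ‖y‖ ^ 2)) := rfl
  set U := coshDistSubOne y x
  set E := Real.exp (-β * U)
  have hE : 0 < E := Real.exp_pos _
  -- In hyperbolic space `ΔU = 3(1 + U)` and `|∇U|² = U² + 2U`, so this is `Δ exp(-βU)` times the
  -- conformal factor `2 / (1 - |x|²)`. It is positive since `βU > 3` gives `βU(U + 2) > 3(U + 2)`.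
  have key : 0 < E * (2 / (1 - ‖x‖ ^ 2) * (β * (β * (U ^ 2 + 2 * U) - 3 * (1 + U)))) := by
    have hβ0 : 0 < β := by
      by_contra! hneg
      nlinarith
    have : 0 < β * (U ^ 2 + 2 * U) - 3 * (1 + U) := by
      have : 3 < β * U := hβ.trans_le (mul_le_mul_of_nonneg_left hU hβ0.le)
      nlinarith
    positivity
  refine key.trans_eq ?_
  have hqs : ‖x - y‖ ^ 2 = ∑ i, (x i - y i) ^ 2 := by rw [norm_sq_eq_sum]; simp
  rw [hU2, invConformalFactor]
  rw [norm_sq_eq_sum x] at hp ⊢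
  rw [norm_sq_eq_sum y] at hk ⊢
  rw [hqs]
  simp only [Fin.sum_univ_three] at hp hk ⊢
  have hp' := hp.ne'
  have hk' := hk.ne'
  field_simp
  ring

/-! ### Covariant calculus and the Bianchi identity -/

/-- The partial derivative in the direction of a vector of the standard basis. -/
noncomputable def partialD {V : Type*} [NormedAddCommGroup V] [NormedSpace ℝ V] (i : Fin 3)
    (g : E3 → V) (x : E3) : V := fderiv ℝ g x (stdVec i)

section
variable {V : Type*} [NormedAddCommGroup V] [NormedSpace ℝ V]

theorem ContDiffAt.partialD {g : E3 → V} {x : E3} (hg : ContDiffAt ℝ (⊤ : ℕ∞) g x) (i : Fin 3) :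
    ContDiffAt ℝ (⊤ : ℕ∞) (partialD i g) x :=
  (hg.fderiv_right (m := (⊤ : ℕ∞)) (by simp)).clm_apply contDiffAt_const

theorem ContDiffAt.differentiableAt_top {W : Type*} [NormedAddCommGroup W] [NormedSpace ℝ W]
    {g : W → V} {x : W} (hg : ContDiffAt ℝ (⊤ : ℕ∞) g x) : DifferentiableAt ℝ g x :=
  hg.differentiableAt (by simp)

theorem partialD_comm {g : E3 → V} {x : E3} (hg : ContDiffAt ℝ (⊤ : ℕ∞) g x) (i j : Fin 3) :
    partialD i (partialD j g) x = partialD j (partialD i g) x := by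
  have hd : DifferentiableAt ℝ (fderiv ℝ g) x :=
    (hg.fderiv_right (m := (⊤ : ℕ∞)) (by simp)).differentiableAt_top
  have h : ∀ i j, partialD i (partialD j g) x = fderiv ℝ (fderiv ℝ g) x (stdVec i) (stdVec j) := by
    intro i j
    have : HasFDerivAt (partialD j g) _ x := hd.hasFDerivAt.clm_apply (hasFDerivAt_const (stdVec j) x)
    rw [partialD, this.fderiv]
    simp
  rw [h, h]
  exact (hg.isSymmSndFDerivAt (by simpa using WithTop.coe_le_coe.2 (le_top (a := (2 : ℕ∞))))).eq _ _

theorem partialD_add {g h : E3 → V} {x : E3} (hg : DifferentiableAt ℝ g x)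
    (hh : DifferentiableAt ℝ h x) (i : Fin 3) :
    partialD i (fun y => g y + h y) x = partialD i g x + partialD i h x := by
  rw [partialD, fderiv_fun_add hg hh]; rfl

theorem partialD_sub {g h : E3 → V} {x : E3} (hg : DifferentiableAt ℝ g x)
    (hh : DifferentiableAt ℝ h x) (i : Fin 3) :
    partialD i (fun y => g y - h y) x = partialD i g x - partialD i h x := by
  rw [partialD, fderiv_fun_sub hg hh]; rfl

theorem partialD_smul {c : E3 → ℝ} {g : E3 → V} {x : E3} (hc : DifferentiableAt ℝ c x)
    (hg : DifferentiableAt ℝ g x) (i : Fin 3) :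
    partialD i (fun y => c y • g y) x = c x • partialD i g x + partialD i c x • g x := by
  rw [partialD, fderiv_fun_smul hc hg]; rfl

theorem partialD_mul {X Y : E3 → EndF} {x : E3} (hX : DifferentiableAt ℝ X x)
    (hY : DifferentiableAt ℝ Y x) (i : Fin 3) :
    partialD i (fun y => X y * Y y) x = X x * partialD i Y x + partialD i X x * Y x := by
  have h := (ContinuousLinearMap.mul ℝ EndF).hasFDerivAt_of_bilinear hX.hasFDerivAt hY.hasFDerivAt
  have h' : HasFDerivAt (fun y => X y * Y y) _ x := h
  rw [partialD, h'.fderiv]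
  rfl

theorem Filter.EventuallyEq.partialD_eq {g h : E3 → V} {x : E3} (e : g =ᶠ[𝓝 x] h) (i : Fin 3) :
    partialD i g x = partialD i h x := by
  rw [partialD, e.fderiv_eq]; rfl

end

theorem ContDiffAt.endF_mul {X Y : E3 → EndF} {x : E3} (hX : ContDiffAt ℝ (⊤ : ℕ∞) X x)
    (hY : ContDiffAt ℝ (⊤ : ℕ∞) Y x) : ContDiffAt ℝ (⊤ : ℕ∞) (fun y => X y * Y y) x :=
  ContDiffAt.mul hX hY

/-- The covariant derivative of an endomorphism in a coordinate direction. -/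
noncomputable def covD (A : E3 → E3 →L[ℝ] EndF) (i : Fin 3) (X : E3 → EndF) (x : E3) : EndF :=
  partialD i X x + (A x (stdVec i) * X x - X x * A x (stdVec i))

/-- The component of the curvature opposite to the `i`-th coordinate direction. -/
noncomputable def dualCurv (A : E3 → E3 →L[ℝ] EndF) (i : Fin 3) (x : E3) : EndF :=
  curvature A x (stdVec (i + 1)) (stdVec (i + 2))

/-- The commutator terms cancel by invariance of the form, so the connection is metric for it. -/
theorem partialD_trForm {A : E3 → E3 →L[ℝ] EndF} {X Y : E3 → EndF} {x : E3}
    (hX : DifferentiableAt ℝ X x) (hY : DifferentiableAt ℝ Y x) (i : Fin 3) :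
    partialD i (fun y => trForm (X y) (Y y)) x =
      trForm (covD A i X x) (Y x) + trForm (X x) (covD A i Y x) := by
  have h := (ContinuousLinearMap.mul ℝ EndF).hasFDerivAt_of_bilinear hX.hasFDerivAt hY.hasFDerivAt
  have h2 := (reTrace.hasFDerivAt.comp x h).const_mul (-(1 / 2) : ℝ)
  have h3 : HasFDerivAt (fun y => trForm (X y) (Y y)) _ x := h2
  have e : partialD i (fun y => trForm (X y) (Y y)) x =
      trForm (X x) (partialD i Y x) + trForm (partialD i X x) (Y x) := by
    rw [partialD, h3.fderiv]
    change -(1 / 2) * reTrace (X x * partialD i Y x + partialD i X x * Y x) = _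
    rw [map_add, trForm, trForm]; ring
  have h4 := trForm_commutator_add (A x (stdVec i)) (X x) (Y x)
  rw [e, covD, covD, trForm_add_left, trForm_comm (X x) (_ + _), trForm_add_left,
    trForm_comm _ (X x), trForm_comm (_ - _) (X x)]
  linarith

section
variable {A : E3 → E3 →L[ℝ] EndF} {x : E3}

theorem ContDiffAt.component (hA : ContDiffAt ℝ (⊤ : ℕ∞) A x) (i : Fin 3) :
    ContDiffAt ℝ (⊤ : ℕ∞) (fun y => A y (stdVec i)) x := hA.clm_apply contDiffAt_const

theorem ContDiffAt.covD (hA : ContDiffAt ℝ (⊤ : ℕ∞) A x) {X : E3 → EndF}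
    (hX : ContDiffAt ℝ (⊤ : ℕ∞) X x) (i : Fin 3) : ContDiffAt ℝ (⊤ : ℕ∞) (covD A i X) x :=
  (hX.partialD i).add (((hA.component i).endF_mul hX).sub (hX.endF_mul (hA.component i)))

theorem partialD_component (hA : DifferentiableAt ℝ A x) (i j : Fin 3) :
    partialD i (fun y => A y (stdVec j)) x = fderiv ℝ A x (stdVec i) (stdVec j) := by
  have : HasFDerivAt (fun y => A y (stdVec j)) _ x :=
    hA.hasFDerivAt.clm_apply (hasFDerivAt_const (stdVec j) x)
  rw [partialD, this.fderiv]
  simp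

theorem dualCurv_eventuallyEq (hA : ∀ᶠ y in 𝓝 x, ContDiffAt ℝ (⊤ : ℕ∞) A y) (i : Fin 3) :
    dualCurv A i =ᶠ[𝓝 x] fun y =>
      partialD (i + 1) (fun y => A y (stdVec (i + 2))) y -
        partialD (i + 2) (fun y => A y (stdVec (i + 1))) y +
      (A y (stdVec (i + 1)) * A y (stdVec (i + 2)) -
        A y (stdVec (i + 2)) * A y (stdVec (i + 1))) := by
  filter_upwards [hA] with y hy
  rw [partialD_component hy.differentiableAt_top, partialD_component hy.differentiableAt_top]
  rfl

theorem contDiffAt_dualCurv (hA : ∀ᶠ y in 𝓝 x, ContDiffAt ℝ (⊤ : ℕ∞) A y) (i : Fin 3) :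
    ContDiffAt ℝ (⊤ : ℕ∞) (dualCurv A i) x := by
  have h := hA.self_of_nhds
  refine ContDiffAt.congr_of_eventuallyEq ?_ (dualCurv_eventuallyEq hA i)
  exact (((h.component _).partialD _).sub ((h.component _).partialD _)).add
    (((h.component _).endF_mul (h.component _)).sub ((h.component _).endF_mul (h.component _)))

theorem covD_dualCurv (hA : ∀ᶠ y in 𝓝 x, ContDiffAt ℝ (⊤ : ℕ∞) A y) (i : Fin 3) :
    covD A i (dualCurv A i) x =
      partialD i (partialD (i + 1) (fun y => A y (stdVec (i + 2)))) x -
        partialD i (partialD (i + 2) (fun y => A y (stdVec (i + 1)))) x +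
      ((A x (stdVec (i + 1)) * partialD i (fun y => A y (stdVec (i + 2))) x +
        partialD i (fun y => A y (stdVec (i + 1))) x * A x (stdVec (i + 2))) -
        (A x (stdVec (i + 2)) * partialD i (fun y => A y (stdVec (i + 1))) x +
        partialD i (fun y => A y (stdVec (i + 2))) x * A x (stdVec (i + 1)))) +
      (A x (stdVec i) * (partialD (i + 1) (fun y => A y (stdVec (i + 2))) x -
        partialD (i + 2) (fun y => A y (stdVec (i + 1))) x +
      (A x (stdVec (i + 1)) * A x (stdVec (i + 2)) -
        A x (stdVec (i + 2)) * A x (stdVec (i + 1)))) -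
      (partialD (i + 1) (fun y => A y (stdVec (i + 2))) x -
        partialD (i + 2) (fun y => A y (stdVec (i + 1))) x +
      (A x (stdVec (i + 1)) * A x (stdVec (i + 2)) -
        A x (stdVec (i + 2)) * A x (stdVec (i + 1)))) * A x (stdVec i)) := by
  have h := hA.self_of_nhds
  have c := h.component
  have e := dualCurv_eventuallyEq hA i
  have d1 := ((c (i + 2)).partialD (i + 1)).differentiableAt_top
  have d2 := ((c (i + 1)).partialD (i + 2)).differentiableAt_top
  have m1 := ((c (i + 1)).endF_mul (c (i + 2))).differentiableAt_top
  have m2 := ((c (i + 2)).endF_mul (c (i + 1))).differentiableAt_top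
  rw [covD, e.partialD_eq, e.self_of_nhds, partialD_add (d1.fun_sub d2) (m1.fun_sub m2),
    partialD_sub d1 d2, partialD_sub m1 m2,
    partialD_mul (c _).differentiableAt_top (c _).differentiableAt_top,
    partialD_mul (c _).differentiableAt_top (c _).differentiableAt_top]

/-- The cancellations in the Bianchi identity: `a i` stands for `Aᵢ`, `p i j` for `∂ᵢ Aⱼ` and
`q k` for the mixed second derivative of `Aₖ`. -/
theorem bianchi_sum {R : Type*} [Ring R] (a0 a1 a2 p01 p02 p10 p12 p20 p21 q0 q1 q2 : R) :
    (q2 - q1 + ((a1 * p02 + p01 * a2) - (a2 * p01 + p02 * a1)) +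
      (a0 * (p12 - p21 + (a1 * a2 - a2 * a1)) - (p12 - p21 + (a1 * a2 - a2 * a1)) * a0)) +
    (q0 - q2 + ((a2 * p10 + p12 * a0) - (a0 * p12 + p10 * a2)) +
      (a1 * (p20 - p02 + (a2 * a0 - a0 * a2)) - (p20 - p02 + (a2 * a0 - a0 * a2)) * a1)) +
    (q1 - q0 + ((a0 * p21 + p20 * a1) - (a1 * p20 + p21 * a0)) +
      (a2 * (p01 - p10 + (a0 * a1 - a1 * a0)) - (p01 - p10 + (a0 * a1 - a1 * a0)) * a2)) = 0 := by
  noncomm_ring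

/-- The Bianchi identity. -/
theorem sum_covD_dualCurv (hA : ∀ᶠ y in 𝓝 x, ContDiffAt ℝ (⊤ : ℕ∞) A y) :
    ∑ i, covD A i (dualCurv A i) x = 0 := by
  have h := hA.self_of_nhds
  simp only [Fin.sum_univ_three, covD_dualCurv hA]
  have e1 : (0 : Fin 3) + 1 = 1 := rfl
  have e2 : (0 : Fin 3) + 2 = 2 := rfl
  have e3 : (1 : Fin 3) + 1 = 2 := rfl
  have e4 : (1 : Fin 3) + 2 = 0 := rfl
  have e5 : (2 : Fin 3) + 1 = 0 := rfl
  have e6 : (2 : Fin 3) + 2 = 1 := rfl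
  simp only [e1, e2, e3, e4, e5, e6]
  rw [partialD_comm (h.component 2) 1 0, partialD_comm (h.component 1) 2 0,
    partialD_comm (h.component 0) 2 1]
  exact bianchi_sum _ _ _ _ _ _ _ _ _ _ _ _

end

/-! ### Derivatives of su(2)-valued fields -/

section
variable {V W : Type*} [NormedAddCommGroup V] [NormedSpace ℝ V] [NormedAddCommGroup W]
  [NormedSpace ℝ W]

theorem ContinuousLinearMap.partialD_eq_zero (T : V →L[ℝ] W) {g : E3 → V} {x : E3}
    (hg : DifferentiableAt ℝ g x) (h : ∀ᶠ y in 𝓝 x, T (g y) = 0) (i : Fin 3) :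
    T (partialD i g x) = 0 := by
  have h1 : HasFDerivAt (fun y => T (g y)) (T ∘L fderiv ℝ g x) x :=
    T.hasFDerivAt.comp x hg.hasFDerivAt
  have h2 : HasFDerivAt (fun y => T (g y)) (0 : E3 →L[ℝ] W) x :=
    (hasFDerivAt_const (0 : W) x).congr_of_eventuallyEq h
  have := DFunLike.congr_fun (h1.unique h2) (stdVec i)
  exact this

end

theorem mem_su2_iff {X : EndF} : X ∈ su2 ↔ ((starL' ℝ : EndF ≃L[ℝ] EndF) : EndF →L[ℝ] EndF) X +
    ContinuousLinearMap.id ℝ EndF X = 0 ∧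
    LinearMap.trace ℂ Fibre (X : Fibre →ₗ[ℂ] Fibre) = 0 := by
  rw [su2, mem_ofPred_eq, ← eq_neg_iff_add_eq_zero]
  rfl

/-- The trace as a real linear map. -/
noncomputable def traceCLM : EndF →L[ℝ] ℂ :=
  LinearMap.toContinuousLinearMap
    (((LinearMap.trace ℂ Fibre) ∘ₗ
      (ContinuousLinearMap.coeLM ℂ : EndF →ₗ[ℂ] (Fibre →ₗ[ℂ] Fibre))).restrictScalars ℝ)

/-- The space su(2) is the common kernel of two continuous real-linear maps, and these commute with
differentiation. -/
theorem partialD_mem_su2 {X : E3 → EndF} {x : E3} (hX : DifferentiableAt ℝ X x)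
    (h : ∀ᶠ y in 𝓝 x, X y ∈ su2) (i : Fin 3) : partialD i X x ∈ su2 := by
  simp only [mem_su2_iff] at h ⊢
  exact ⟨(((starL' ℝ : EndF ≃L[ℝ] EndF) : EndF →L[ℝ] EndF) +
    ContinuousLinearMap.id ℝ EndF).partialD_eq_zero hX (h.mono fun _ => And.left) i,
    traceCLM.partialD_eq_zero hX (h.mono fun _ => And.right) i⟩

theorem add_mem_su2 {X Y : EndF} (hX : X ∈ su2) (hY : Y ∈ su2) : X + Y ∈ su2 := by
  refine ⟨?_, ?_⟩
  · refine (star_add X Y).trans ?_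
    rw [hX.1, hY.1]
    exact (neg_add X Y).symm
  · have e : ((X + Y : EndF) : Fibre →ₗ[ℂ] Fibre) = (X : Fibre →ₗ[ℂ] Fibre) + Y := rfl
    rw [e, map_add, hX.2, hY.2, add_zero]

theorem commutator_mem_su2 {X Y : EndF} (hX : X ∈ su2) (hY : Y ∈ su2) :
    X * Y - Y * X ∈ su2 := by
  refine ⟨?_, ?_⟩
  · have neg_commutator : ∀ {R : Type _} [Ring R] (X Y : R),
        -Y * -X - -X * -Y = -(X * Y - Y * X) := by
      intro R _ X Y
      noncomm_ring
    refine (star_sub (X * Y) (Y * X)).trans ?_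
    rw [star_mul, star_mul, hX.1, hY.1]
    exact neg_commutator X Y
  · have e : ((X * Y - Y * X : EndF) : Fibre →ₗ[ℂ] Fibre) =
      (X : Fibre →ₗ[ℂ] Fibre) * Y - (Y : Fibre →ₗ[ℂ] Fibre) * X := rfl
    rw [e, map_sub, LinearMap.trace_mul_comm, sub_self]

theorem ContDiffAt.trForm {X Y : E3 → EndF} {x : E3} (hX : ContDiffAt ℝ (⊤ : ℕ∞) X x)
    (hY : ContDiffAt ℝ (⊤ : ℕ∞) Y x) :
    ContDiffAt ℝ (⊤ : ℕ∞) (fun y => trForm (X y) (Y y)) x :=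
  contDiffAt_const.mul (reTrace.contDiff.contDiffAt.comp x (hX.endF_mul hY))

theorem hasLineJet_of_contDiffAt {f : E3 → ℝ} {x : E3}
    (hf : ∀ᶠ y in 𝓝 x, ContDiffAt ℝ (⊤ : ℕ∞) f y) (i : Fin 3) :
    HasLineJet f x (stdVec i) (partialD i f x) (partialD i (partialD i f) x) := by
  have hl : ∀ t : ℝ, HasDerivAt (fun t : ℝ => x + t • stdVec i) (stdVec i) t := fun t => by
    simpa using ((hasDerivAt_id t).smul_const (stdVec i)).const_add x
  have key : ∀ (g : E3 → ℝ) (t : ℝ), DifferentiableAt ℝ g (x + t • stdVec i) →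
      HasDerivAt (fun t : ℝ => g (x + t • stdVec i)) (partialD i g (x + t • stdVec i)) t :=
    fun g t hg => hg.hasFDerivAt.comp_hasDerivAt t (hl t)
  refine ⟨fun t => partialD i f (x + t • stdVec i), ?_, by simp, ?_⟩
  · have hc : Tendsto (fun t : ℝ => x + t • stdVec i) (𝓝 0) (𝓝 x) := by
      simpa using (hl 0).continuousAt.tendsto
    filter_upwards [hc.eventually hf] with t ht using key f t ht.differentiableAt_top
  · have := key (partialD i f) 0 (by simpa using (hf.self_of_nhds.partialD i).differentiableAt_top)
    simpa using this

theorem Filter.EventuallyEq.covD_eq {A : E3 → E3 →L[ℝ] EndF} {X Y : E3 → EndF} {x : E3}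
    (e : X =ᶠ[𝓝 x] Y) (i : Fin 3) : covD A i X x = covD A i Y x := by
  rw [covD, e.partialD_eq, e.self_of_nhds, covD]

theorem endF_mul_smul (c : ℝ) (X Y : EndF) : X * (c • Y) = c • (X * Y) := by
  ext1 v
  exact X.map_smul_of_tower c (Y v)

theorem covD_smul {A : E3 → E3 →L[ℝ] EndF} {c : E3 → ℝ} {X : E3 → EndF} {x : E3}
    (hc : DifferentiableAt ℝ c x) (hX : DifferentiableAt ℝ X x) (i : Fin 3) :
    covD A i (fun y => c y • X y) x = c x • covD A i X x + partialD i c x • X x := by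
  have e1 : A x (stdVec i) * (c x • X x) = c x • (A x (stdVec i) * X x) :=
    endF_mul_smul _ _ _
  have e2 : (c x • X x) * A x (stdVec i) = c x • (X x * A x (stdVec i)) := rfl
  rw [covD, partialD_smul hc hX, covD, e1, e2]
  module

theorem contDiff_invConformalFactor : ContDiff ℝ (⊤ : ℕ∞) invConformalFactor :=
  (contDiff_const.sub (contDiff_norm_sq ℝ)).div_const 2

theorem partialD_invConformalFactor (x : E3) (i : Fin 3) :
    partialD i invConformalFactor x = -x i := by
  have h : HasFDerivAt invConformalFactor _ x :=
    (((hasStrictFDerivAt_norm_sq x).hasFDerivAt).const_sub 1).mul_const (2⁻¹ : ℝ)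
  rw [partialD, h.fderiv]
  simp [stdVec, EuclideanSpace.inner_single_right]

/-! ### Subharmonicity of the squared Higgs field and its upper bound -/

namespace HyperbolicMonopole

variable (M : HyperbolicMonopole)

theorem eventually_mem {x : E3} (hx : x ∈ hyperbolicBall) : ∀ᶠ y in 𝓝 x, y ∈ hyperbolicBall :=
  Metric.isOpen_ball.mem_nhds hx

theorem contDiffAt_A {x : E3} (hx : x ∈ hyperbolicBall) : ContDiffAt ℝ (⊤ : ℕ∞) M.A x :=
  M.smooth_A.contDiffAt (eventually_mem hx)

theorem contDiffAt_Φ {x : E3} (hx : x ∈ hyperbolicBall) : ContDiffAt ℝ (⊤ : ℕ∞) M.Φ x :=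
  M.smooth_Φ.contDiffAt (eventually_mem hx)

/-- The squared norm of the Higgs field, in a form that is visibly smooth. -/
noncomputable def energy (x : E3) : ℝ := trForm (M.Φ x) (M.Φ x)

theorem energy_eq {x : E3} (hx : x ∈ hyperbolicBall) : M.energy x = ‖M.Φ x‖ ^ 2 :=
  trForm_self (M.Φ_mem x hx)

theorem contDiffAt_energy {x : E3} (hx : x ∈ hyperbolicBall) :
    ContDiffAt ℝ (⊤ : ℕ∞) M.energy x := (M.contDiffAt_Φ hx).trForm (M.contDiffAt_Φ hx)

theorem covD_Φ {x : E3} (hx : x ∈ hyperbolicBall) (i : Fin 3) :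
    covD M.A i M.Φ x = invConformalFactor x • dualCurv M.A i x := M.bogomolny x hx i

theorem covD_Φ_mem {x : E3} (hx : x ∈ hyperbolicBall) (i : Fin 3) : covD M.A i M.Φ x ∈ su2 :=
  add_mem_su2 (partialD_mem_su2 (M.contDiffAt_Φ hx).differentiableAt_top
    ((eventually_mem hx).mono M.Φ_mem) i)
    (commutator_mem_su2 (M.A_mem x hx _) (M.Φ_mem x hx))

theorem partialD_energy {x : E3} (hx : x ∈ hyperbolicBall) (i : Fin 3) :
    partialD i M.energy x = 2 * trForm (covD M.A i M.Φ x) (M.Φ x) := by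
  have hd := (M.contDiffAt_Φ hx).differentiableAt_top
  have h : partialD i M.energy x = _ := partialD_trForm (A := M.A) hd hd i
  rw [h, trForm_comm (M.Φ x)]
  ring

theorem partialD_partialD_energy {x : E3} (hx : x ∈ hyperbolicBall) (i : Fin 3) :
    partialD i (partialD i M.energy) x =
      2 * (trForm (covD M.A i (covD M.A i M.Φ) x) (M.Φ x) + ‖covD M.A i M.Φ x‖ ^ 2) := by
  have hΦ := M.contDiffAt_Φ hx
  have hD := (M.contDiffAt_A hx).covD hΦ i
  have hT := (hD.trForm hΦ).differentiableAt_top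
  have e : partialD i M.energy =ᶠ[𝓝 x] fun y =>
      trForm (covD M.A i M.Φ y) (M.Φ y) + trForm (covD M.A i M.Φ y) (M.Φ y) := by
    filter_upwards [eventually_mem hx] with y hy
    rw [M.partialD_energy hy]; ring
  rw [e.partialD_eq, partialD_add hT hT,
    partialD_trForm (A := M.A) hD.differentiableAt_top hΦ.differentiableAt_top,
    trForm_self (M.covD_Φ_mem hx i)]
  ring

theorem covD_covD_Φ {x : E3} (hx : x ∈ hyperbolicBall) (i : Fin 3) :
    covD M.A i (covD M.A i M.Φ) x =
      invConformalFactor x • covD M.A i (dualCurv M.A i) x + (-x i) • dualCurv M.A i x := by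
  have e : covD M.A i M.Φ =ᶠ[𝓝 x] fun y => invConformalFactor y • dualCurv M.A i y :=
    (eventually_mem hx).mono fun y hy => M.covD_Φ hy i
  rw [e.covD_eq, covD_smul contDiff_invConformalFactor.contDiffAt.differentiableAt_top
    (contDiffAt_dualCurv ((eventually_mem hx).mono fun y => M.contDiffAt_A) i).differentiableAt_top,
    partialD_invConformalFactor]

/-- The Weitzenböck formula `Δ |Φ|² = 2 |d_A Φ|²` of hyperbolic space. -/
theorem laplacian_energy {x : E3} (hx : x ∈ hyperbolicBall) :
    invConformalFactor x * ∑ i, partialD i (partialD i M.energy) x +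
      ∑ i, x i * partialD i M.energy x =
    2 * invConformalFactor x * ∑ i, ‖covD M.A i M.Φ x‖ ^ 2 := by
  have hb := sum_covD_dualCurv ((eventually_mem hx).mono fun y => M.contDiffAt_A)
  have hb' := congrArg (fun X => trForm X (M.Φ x)) hb
  have h0 : trForm 0 (M.Φ x) = 0 := by simp [trForm]
  simp only [Fin.sum_univ_three, trForm_add_left, h0] at hb'
  simp only [M.partialD_partialD_energy hx, M.partialD_energy hx, M.covD_covD_Φ hx,
    Fin.sum_univ_three, trForm_add_left, trForm_smul_left]
  simp only [M.covD_Φ hx, trForm_smul_left]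
  -- Differentiating the factor `λ⁻¹` in the Bogomolny equation yields `-xᵢ Fᵢ`, which cancels the
  -- first-order part of the Laplacian; what remains besides the squares is the Bianchi sum paired
  -- with `Φ`.
  linear_combination 2 * invConformalFactor x ^ 2 * hb'

theorem hasLineJet_energy {x : E3} (hx : x ∈ hyperbolicBall) (i : Fin 3) :
    HasLineJet M.energy x (stdVec i) (partialD i M.energy x)
      (partialD i (partialD i M.energy) x) :=
  hasLineJet_of_contDiffAt ((eventually_mem hx).mono fun _ => M.contDiffAt_energy) i

theorem continuousOn_energy : ContinuousOn M.energy hyperbolicBall := fun _ hx =>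
  (M.contDiffAt_energy hx).continuousAt.continuousWithinAt

theorem one_sub_norm_sq_mem {x : E3} (hx : x ∈ hyperbolicBall) :
    0 < 1 - ‖x‖ ^ 2 ∧ 1 - ‖x‖ ^ 2 ≤ 1 := by
  have : ‖x‖ < 1 := mem_ball_zero_iff.1 hx
  constructor <;> nlinarith [norm_nonneg x]

theorem laplacian_energy_nonneg {x : E3} (hx : x ∈ hyperbolicBall) :
    0 ≤ invConformalFactor x * ∑ i, partialD i (partialD i M.energy) x +
      ∑ i, x i * partialD i M.energy x := by
  rw [M.laplacian_energy hx]
  have : 0 ≤ invConformalFactor x := div_nonneg (one_sub_norm_sq_mem hx).1.le zero_le_two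
  positivity

theorem eventually_mem_ball :
    ∀ᶠ x in comap (fun x : E3 => ‖x‖) (𝓝[<] 1), x ∈ hyperbolicBall := by
  have : ∀ᶠ r in 𝓝[<] (1 : ℝ), r < 1 := self_mem_nhdsWithin
  filter_upwards [tendsto_comap.eventually this] with x hx using mem_ball_zero_iff.2 hx

theorem eventually_energy_lt {K : ℝ} (hK : M.mass ^ 2 < K) :
    ∀ᶠ x in comap (fun x : E3 => ‖x‖) (𝓝[<] 1), M.energy x < K := by
  filter_upwards [eventually_mem_ball, (M.tendsto_norm_Φ.pow 2).eventually (gt_mem_nhds hK)]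
    with x hx h
  rwa [M.energy_eq hx]

/-- A comparison function with strictly positive Laplacian, added to the energy, satisfies the
maximum principle. -/
theorem energy_add_le {η : ℝ} (hη : 0 < η) {k : E3 → ℝ} (hk : ContinuousOn k hyperbolicBall)
    (hlim : ∀ K' > 0, ∀ᶠ x in comap (fun x : E3 => ‖x‖) (𝓝[<] 1), k x < K')
    (hL : ∀ x ∈ hyperbolicBall, M.energy x + η * k x ≤ M.mass ^ 2 ∨ ∃ a b : Fin 3 → ℝ,
      (∀ i, HasLineJet k x (stdVec i) (a i) (b i)) ∧
      0 < invConformalFactor x * ∑ i, b i + ∑ i, x i * a i) :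
    ∀ x ∈ hyperbolicBall, M.energy x + η * k x ≤ M.mass ^ 2 := by
  refine le_of_strict_subsolution (M.continuousOn_energy.add (continuousOn_const.mul hk))
    (fun K' hK' => ?_) fun x hx => (hL x hx).imp_right ?_
  · have h1 : M.mass ^ 2 < (M.mass ^ 2 + K') / 2 := by linarith
    have h2 : 0 < (K' - M.mass ^ 2) / (2 * η) := div_pos (sub_pos.2 hK') (by positivity)
    filter_upwards [M.eventually_energy_lt h1, hlim _ h2] with x hx hkx
    rw [lt_div_iff₀ (by positivity)] at hkx
    linarith
  · rintro ⟨a, b, hj, hpos⟩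
    refine ⟨_, _, fun i => (M.hasLineJet_energy hx i).add_const_mul (hj i) η, ?_⟩
    have h1 := M.laplacian_energy_nonneg hx
    have h2 := mul_pos hη hpos
    simp only [Fin.sum_univ_three] at h1 h2 ⊢
    linarith

/-- The comparison function is `|x|² - 1`: negative in the ball, at least -1, and with `λ` times its
Laplacian equal to `3 - |x|² > 0`. -/
theorem energy_le {x : E3} (hx : x ∈ hyperbolicBall) : M.energy x ≤ M.mass ^ 2 := by
  by_contra! hlt
  have hη : 0 < (M.energy x - M.mass ^ 2) / 2 := by linarith
  have h := M.energy_add_le hη (k := fun y => 0 + (-1) * (1 - ‖y‖ ^ 2)) (by fun_prop)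
    (fun K' hK' => by
      filter_upwards [eventually_mem_ball] with y hy
      linarith [(one_sub_norm_sq_mem hy).1])
    (fun y hy => Or.inr ⟨_, _, fun i => (HasLineJet.const 0 y (stdVec i)).add_const_mul
      (hasLineJet_one_sub_norm_sq y i) (-1), by
        have h1 := (one_sub_norm_sq_mem hy).1
        have h2 := norm_sq_eq_sum y
        simp only [Fin.sum_univ_three, invConformalFactor] at h2 ⊢
        nlinarith [sq_nonneg (y 0), sq_nonneg (y 1), sq_nonneg (y 2)]⟩) x hx
  nlinarith [one_sub_norm_sq_mem hx]

theorem coshDistSubOne_ge {x y : E3} (hx : x ∈ hyperbolicBall) (hy : y ∈ hyperbolicBall) :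
    2 * ‖x - y‖ ^ 2 / (1 - ‖x‖ ^ 2) ≤ coshDistSubOne y x := by
  have h1 := one_sub_norm_sq_mem hx
  have h2 := one_sub_norm_sq_mem hy
  refine div_le_div_of_nonneg_left (by positivity) (mul_pos h1.1 h2.1) ?_
  nlinarith

/-- Uses `exp(-βU) ≤ 1 / (βU)`, where `U` grows at least like `1 / (1 - |x|²)` once `x` stays a
fixed distance `d` from `y`. -/
theorem eventually_barrier_lt {y : E3} (hy : y ∈ hyperbolicBall) {β : ℝ} (hβ : 0 < β) {K : ℝ}
    (hK : 0 < K) :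
    ∀ᶠ x in comap (fun x : E3 => ‖x‖) (𝓝[<] 1), Real.exp (-β * coshDistSubOne y x) < K := by
  have hy1 : ‖y‖ < 1 := mem_ball_zero_iff.1 hy
  have hd : 0 < (1 - ‖y‖) / 2 := by linarith
  set d := (1 - ‖y‖) / 2 with hddef
  have h1 : ∀ᶠ r in 𝓝[<] (1 : ℝ), ‖y‖ + d < r :=
    mem_nhdsWithin_of_mem_nhds (lt_mem_nhds (by linarith))
  have h2 : ∀ᶠ r in 𝓝[<] (1 : ℝ), (1 - r ^ 2) / (β * (2 * d ^ 2)) < K := by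
    refine mem_nhdsWithin_of_mem_nhds (ContinuousAt.eventually_lt
      (f := fun r : ℝ => (1 - r ^ 2) / (β * (2 * d ^ 2))) (by fun_prop) continuousAt_const ?_)
    simpa using hK
  filter_upwards [eventually_mem_ball, tendsto_comap.eventually h1, tendsto_comap.eventually h2]
    with x hx hx1 hx2
  have hp := (one_sub_norm_sq_mem hx).1
  have hxy : d ≤ ‖x - y‖ := by linarith [norm_sub_norm_le x y]
  have hU : 2 * d ^ 2 / (1 - ‖x‖ ^ 2) ≤ coshDistSubOne y x :=
    (by gcongr : 2 * d ^ 2 / (1 - ‖x‖ ^ 2) ≤ 2 * ‖x - y‖ ^ 2 / (1 - ‖x‖ ^ 2)).trans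
      (coshDistSubOne_ge hx hy)
  refine lt_of_le_of_lt ?_ hx2
  rw [neg_mul, Real.exp_neg]
  have hpos : 0 < β * (2 * d ^ 2 / (1 - ‖x‖ ^ 2)) := by positivity
  have hle : β * (2 * d ^ 2 / (1 - ‖x‖ ^ 2)) ≤ Real.exp (β * coshDistSubOne y x) :=
    (mul_le_mul_of_nonneg_left hU hβ.le).trans (by
      linarith [Real.add_one_le_exp (β * coshDistSubOne y x)])
  refine (inv_anti₀ hpos hle).trans_eq ?_
  field_simp

theorem continuousOn_coshDistSubOne {y : E3} (hy : y ∈ hyperbolicBall) :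
    ContinuousOn (coshDistSubOne y) hyperbolicBall := by
  refine ContinuousOn.div (by fun_prop) (by fun_prop) fun x hx => ?_
  exact (mul_pos (one_sub_norm_sq_mem hx).1 (one_sub_norm_sq_mem hy).1).ne'

theorem energy_lt_of_exists {y : E3} (hy : y ∈ hyperbolicBall) (hlt : M.energy y < M.mass ^ 2)
    {x : E3} (hx : x ∈ hyperbolicBall) : M.energy x < M.mass ^ 2 := by
  -- Half the gap at `y` is left for the barrier, which is at most 1: within distance `ρ` the sum
  -- stays below `m²` directly. Farther away `U ≥ 2ρ²`, and `β = 4 / (2ρ²)` gives `βδ = 4 > 3`.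
  set η := (M.mass ^ 2 - M.energy y) / 2 with hηdef
  have hη : 0 < η := by linarith
  obtain ⟨ρ, hρ, hball⟩ := Metric.eventually_nhds_iff.1
    ((M.contDiffAt_energy hy).continuousAt.eventually
      (gt_mem_nhds (show M.energy y < M.mass ^ 2 - η by linarith)))
  have hδ : 0 < 2 * ρ ^ 2 := by positivity
  have hβ : 0 < 4 / (2 * ρ ^ 2) := by positivity
  have hβδ : 4 / (2 * ρ ^ 2) * (2 * ρ ^ 2) = 4 := div_mul_cancel₀ _ hδ.ne'
  have h := M.energy_add_le hη (k := fun x => Real.exp (-(4 / (2 * ρ ^ 2)) * coshDistSubOne y x))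
    (Real.continuous_exp.comp_continuousOn
      (continuousOn_const.mul (continuousOn_coshDistSubOne hy)))
    (fun K hK => eventually_barrier_lt hy hβ hK) (fun w hw => by
      have hU := coshDistSubOne_ge hw hy
      have hp := one_sub_norm_sq_mem hw
      rcases lt_or_ge ‖w - y‖ ρ with hwy | hwy
      · left
        have h1 := hball (by rwa [dist_eq_norm])
        have h2 : Real.exp (-(4 / (2 * ρ ^ 2)) * coshDistSubOne y w) ≤ 1 := by
          rw [Real.exp_le_one_iff, neg_mul, neg_nonpos]
          exact mul_nonneg hβ.le (le_trans (div_nonneg (by positivity) hp.1.le) hU)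
        nlinarith
      · right
        refine exists_hasLineJet_barrier hy hw hδ (by rw [hβδ]; norm_num) (le_trans ?_ hU)
        rw [le_div_iff₀ hp.1]
        have : ρ ^ 2 ≤ ‖w - y‖ ^ 2 := by gcongr
        nlinarith) x hx
  have := mul_pos hη (Real.exp_pos (-(4 / (2 * ρ ^ 2)) * coshDistSubOne y x))
  linarith

end HyperbolicMonopole

/-! ### From vanishing curvature components to the strict bound -/

/-- The curvature as a linear map in its first argument. -/
noncomputable def curvatureLin (A : E3 → E3 →L[ℝ] EndF) (x v : E3) : E3 →ₗ[ℝ] EndF where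
  toFun u := curvature A x u v
  map_add' u w := by
    simp only [curvature, map_add, _root_.add_apply]
    noncomm_ring
  map_smul' c u := by
    have e1 : (c • A x u) * A x v = c • (A x u * A x v) := rfl
    have e2 : A x v * (c • A x u) = c • (A x v * A x u) := endF_mul_smul _ _ _
    simp only [curvature, map_smul, _root_.smul_apply, e1, e2, RingHom.id_apply]
    module

theorem curvature_swap (A : E3 → E3 →L[ℝ] EndF) (x u v : E3) :
    curvature A x u v = -curvature A x v u := by
  simp only [curvature]
  noncomm_ring

theorem curvature_eq_zero_of_stdVec {A : E3 → E3 →L[ℝ] EndF} {x v : E3}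
    (h : ∀ i, curvature A x (stdVec i) v = 0) (u : E3) : curvature A x u v = 0 := by
  have : curvatureLin A x v = 0 :=
    (EuclideanSpace.basisFun (Fin 3) ℝ).toBasis.ext fun i => by
      simpa [curvatureLin, stdVec] using h i
  exact DFunLike.congr_fun this u

theorem curvature_eq_zero_of_dualCurv {A : E3 → E3 →L[ℝ] EndF} {x : E3}
    (h : ∀ i, dualCurv A i x = 0) (u v : E3) : curvature A x u v = 0 := by
  have hself : ∀ w, curvature A x w w = 0 := fun w => by simp only [curvature, sub_self, add_zero]
  have hst : ∀ i j, curvature A x (stdVec i) (stdVec j) = 0 := by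
    intro i j
    -- Two distinct indices modulo 3 are consecutive in one order, so each pair is, up to sign, a
    -- dual component, with index the successor's successor of the first.
    obtain rfl | rfl | rfl : j = i ∨ j = i + 1 ∨ i = j + 1 := by revert i j; decide
    · exact hself _
    · have e : i = i + 2 + 1 ∧ i + 1 = i + 2 + 2 := by revert i; decide
      have := h (i + 2)
      rwa [dualCurv, ← e.1, ← e.2] at this
    · have e : j = j + 2 + 1 ∧ j + 1 = j + 2 + 2 := by revert j; decide
      have := h (j + 2)
      rw [dualCurv, ← e.1, ← e.2] at this
      rw [curvature_swap, this, neg_zero]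
  refine curvature_eq_zero_of_stdVec (fun i => ?_) u
  rw [curvature_swap, curvature_eq_zero_of_stdVec (fun j => hst j i) v, neg_zero]

namespace HyperbolicMonopole

variable (M : HyperbolicMonopole)

/-- If `|Φ|²` were constantly `m²`, the Weitzenböck formula would force `d_A Φ = 0`, and the
Bogomolny equation would then kill the curvature. -/
theorem exists_energy_lt (hM : M.Nontrivial) : ∃ x ∈ hyperbolicBall, M.energy x < M.mass ^ 2 := by
  by_contra! hge
  obtain ⟨x, hx, u, v, hne⟩ := hM
  have hc : ∀ y ∈ hyperbolicBall, M.energy y = M.mass ^ 2 := fun y hy =>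
    le_antisymm (M.energy_le hy) (hge y hy)
  have hp : 0 < invConformalFactor x := div_pos (one_sub_norm_sq_mem hx).1 two_pos
  have h1 : ∀ y ∈ hyperbolicBall, ∀ i, partialD i M.energy y = 0 := by
    intro y hy i
    have e : M.energy =ᶠ[𝓝 y] fun _ => M.mass ^ 2 := (eventually_mem hy).mono hc
    rw [e.partialD_eq]
    simp [partialD]
  have h2 : ∀ i, partialD i (partialD i M.energy) x = 0 := by
    intro i
    have e : partialD i M.energy =ᶠ[𝓝 x] fun _ => 0 :=
      (eventually_mem hx).mono fun y hy => h1 y hy i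
    rw [e.partialD_eq]
    simp [partialD]
  have h3 := M.laplacian_energy hx
  simp only [h1 x hx, h2, mul_zero, Finset.sum_const_zero, add_zero] at h3
  have h4 : ∑ i, ‖covD M.A i M.Φ x‖ ^ 2 = 0 :=
    (mul_eq_zero.1 h3.symm).resolve_left (by positivity)
  rw [Finset.sum_eq_zero_iff_of_nonneg fun i _ => by positivity] at h4
  refine hne (curvature_eq_zero_of_dualCurv (fun i => ?_) u v)
  have h5 : covD M.A i M.Φ x = 0 := by simpa using h4 i (Finset.mem_univ i)
  rw [M.covD_Φ hx] at h5
  exact (smul_eq_zero.1 h5).resolve_left hp.ne'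

/-- The Higgs field of a nontrivial monopole is everywhere shorter than the mass. -/
theorem norm_Φ_lt_mass (hM : M.Nontrivial) {x : E3} (hx : x ∈ hyperbolicBall) :
    ‖M.Φ x‖ < M.mass := by
  obtain ⟨y, hy, hlt⟩ := M.exists_energy_lt hM
  have h := M.energy_lt_of_exists hy hlt hx
  rw [M.energy_eq hx] at h
  exact lt_of_pow_lt_pow_left₀ 2 M.mass_pos.le h

end HyperbolicMonopole

theorem mainTheorem11 (M : HyperbolicMonopole) (hM : M.Nontrivial) :
    (∀ (n : ℕ) [NeZero n] (z : Fin n → Boundary), (∀ i, z i ≠ z (i + 1)) →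
      ∀ c : ℂ, M.IsNPointValue z c → ‖c‖ < 1) ∧
    (∀ (𝒜 : Type*) [NonUnitalRing 𝒜] [StarRing 𝒜] [Module ℂ 𝒜] [IsScalarTower ℂ 𝒜 𝒜]
      [SMulCommClass ℂ 𝒜 𝒜] [StarModule ℂ 𝒜] (S : ExpectationAlgebra M 𝒜) (z₁ z₂ : Boundary),
      z₁ ≠ z₂ → S.P z₁ ≠ S.P z₂) := by
  have hΦ : ∀ x ∈ hyperbolicBall, ‖M.Φ x‖ < M.mass := fun x hx => M.norm_Φ_lt_mass hM hx
  refine ⟨fun n _ z _ c hc => hc.norm_lt_one hΦ, ?_⟩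
  intro 𝒜 _ _ _ _ _ _ S z₁ z₂ hz
  exact HyperbolicMonopole.P_ne_of_norm_Φ_lt hΦ S hz
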